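/- A Boolean circuit on the variables $x_1,\dots,x_n$ is a finite directed acyclic graph whose nodes are input variables, NOT gates, and AND and OR gates of unbounded fan-in and fan-out, with one designated output node. Its size is the number of its AND and OR gates, and its depth is the largest number of AND and OR gates on a path to the output; NOT gates are free in both measures. Let $\mathrm{PAR}_n(x_1,\dots,x_n)=x_1+\cdots+x_n \bmod 2$. Theorem. For every integer $d\ge 2$ there is an $n_0=n_0(d)$ such that for all $n\ge n_0$, no Boolean circuit of depth at most $d$ and size at most $2^{\frac{1}{11}n^{1/(d-1)}}$ computes $\mathrm{PAR}_n$. -/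

import Mathlib

/-- The label of a node in a Boolean circuit over the variables `x_0, …, x_{n-1}`, when the node
may read the values of `k` earlier nodes: an input variable, a NOT gate, or an AND or OR gate of
unbounded fan-in. (The empty AND is the constant true, the empty OR the constant false.) -/
inductive BooleanGate (n k : ℕ) where
  | var (i : Fin n)
  | not (j : Fin k)
  | and (s : Finset (Fin k))
  | or (s : Finset (Fin k))

/-- Whether a node is an AND gate or an OR gate (these are the gates that are counted). -/
def BooleanGate.isAndOr {n k : ℕ} : BooleanGate n k → Bool
  | .var _ => false
  | .not _ => false
  | .and _ => true
  | .or _ => true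

/-- A Boolean circuit on `n` variables: a finite directed acyclic graph of nodes with a designated
output node. The nodes are listed in a topological order, so that node `k` reads only nodes
`j < k`; the values may be reused arbitrarily often (unbounded fan-out). -/
structure BooleanCircuit (n : ℕ) where
  numNodes : ℕ
  node : (k : Fin numNodes) → BooleanGate n k.val
  output : Fin numNodes

namespace BooleanCircuit

variable {n : ℕ}

/-- The value of node `k` on the input `x`. -/
def nodeVal (C : BooleanCircuit n) (x : Fin n → Bool) (k : Fin C.numNodes) : Bool :=
  match C.node k with
  | .var i => x i
  | .not j => !(C.nodeVal x ⟨j.val, j.isLt.trans k.isLt⟩)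
  | .and s => decide (∀ j ∈ s, C.nodeVal x ⟨j.val, j.isLt.trans k.isLt⟩ = true)
  | .or s => decide (∃ j ∈ s, C.nodeVal x ⟨j.val, j.isLt.trans k.isLt⟩ = true)
termination_by k.val
decreasing_by all_goals exact Fin.isLt _

/-- The largest number of AND/OR gates on a directed path that ends in node `k`. -/
def nodeDepth (C : BooleanCircuit n) (k : Fin C.numNodes) : ℕ :=
  match C.node k with
  | .var _ => 0
  | .not j => C.nodeDepth ⟨j.val, j.isLt.trans k.isLt⟩
  | .and s => s.sup (fun j => C.nodeDepth ⟨j.val, j.isLt.trans k.isLt⟩) + 1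
  | .or s => s.sup (fun j => C.nodeDepth ⟨j.val, j.isLt.trans k.isLt⟩) + 1
termination_by k.val
decreasing_by all_goals exact Fin.isLt _

/-- The depth of a circuit: the largest number of AND/OR gates on a path to the output. -/
def depth (C : BooleanCircuit n) : ℕ := C.nodeDepth C.output

/-- The size of a circuit: its number of AND and OR gates. -/
def size (C : BooleanCircuit n) : ℕ :=
  (Finset.univ.filter (fun k => (C.node k).isAndOr = true)).card

/-- The circuit `C` computes the Boolean function `f`. -/
def Computes (C : BooleanCircuit n) (f : (Fin n → Bool) → Bool) : Prop :=
  ∀ x : Fin n → Bool, C.nodeVal x C.output = f x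

end BooleanCircuit

/-- The parity function `PAR_n`: the sum of the input bits modulo 2. -/
def parity (n : ℕ) (x : Fin n → Bool) : Bool :=
  decide ((∑ i, (x i).toNat) % 2 = 1)

/-! The proof is by random restrictions. If all nodes of depth at most `i` are decision trees of
depth `w`, then an OR gate one level up is a DNF of width `w`, and an AND gate is the negation of
one. By Håstad's switching lemma (`switching`), most restrictions turn such a gate into a shallow
decision tree. A union bound over the gates (`exists_good_restriction`) finds one restriction that
works for all of them at once, and parity on the remaining variables still flips with each variable
(`Simplified.step`). After `d - 1` rounds the output or its negation has certificates of size `w`,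
impossible with more than `w` free variables (`FlipsAll.card_le_of_hasCert`).

The switching lemma is proved by counting. A bad restriction with `l` stars is encoded as one with
`l - s` stars, and each of the latter has at most `(2 * K) ^ s` decodings (`mem_decodeSet`,
`card_decodeSet_le`). There are fewer restrictions with `l - s` stars by a factor of about `(2 * l /
(n - l)) ^ s`.

The first round has `w = 1` and costs only a factor 12 in the number of variables. The other `d - 2`
rounds each cost a factor of about `4 * e * w / log 2`. Hence the exponent `1 / (d - 1)`, and the
constant 1/11 from `4 * e < 11`. -/

/-! ### Decision trees -/

/-- Decision trees over the variables `V`. -/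
inductive DTree (V : Type) where
  | leaf (b : Bool)
  | node (v : V) (l r : DTree V)

namespace DTree

variable {V W : Type}

/-- The value of a decision tree: the right branch is taken when the queried bit is true. -/
def eval : DTree V → (V → Bool) → Bool
  | leaf b, _ => b
  | node v l r, x => if x v then r.eval x else l.eval x

/-- The depth of a decision tree. -/
def depth : DTree V → ℕ
  | leaf _ => 0
  | node _ l r => max l.depth r.depth + 1

/-- Negate all leaves. -/
def neg : DTree V → DTree V
  | leaf b => leaf (!b)
  | node v l r => node v l.neg r.neg

theorem eval_neg (t : DTree V) (x : V → Bool) : t.neg.eval x = !t.eval x := by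
  induction t with
  | leaf b => rfl
  | node v l r hl hr => simp only [neg, eval, hl, hr]; split <;> rfl

theorem depth_neg (t : DTree V) : t.neg.depth = t.depth := by
  induction t with
  | leaf b => rfl
  | node v l r hl hr => simp only [neg, depth, hl, hr]

/-- Substitute constants and variables for the variables of a decision tree. -/
def subst (σ : V → Bool ⊕ W) : DTree V → DTree W
  | leaf b => leaf b
  | node v l r =>
    match σ v with
    | .inl b => if b then r.subst σ else l.subst σ
    | .inr w => node w (l.subst σ) (r.subst σ)

theorem eval_subst (σ : V → Bool ⊕ W) (t : DTree V) (x : W → Bool) :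
    (t.subst σ).eval x = t.eval fun v => Sum.elim id x (σ v) := by
  induction t with
  | leaf b => rfl
  | node v l r hl hr =>
    rcases h : σ v with b | w
    · cases b <;> simp [subst, eval, h, hl, hr]
    · simp [subst, eval, h, hl, hr]

theorem depth_subst_le (σ : V → Bool ⊕ W) (t : DTree V) : (t.subst σ).depth ≤ t.depth := by
  induction t with
  | leaf b => exact le_rfl
  | node v l r hl hr =>
    rcases h : σ v with b | w
    · cases b <;> simp only [subst, depth, h] <;> simp <;> omega
    · simp only [subst, depth, h]; omega

/-- The variables that a decision tree queries on a given input. -/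
def queried [DecidableEq V] : DTree V → (V → Bool) → Finset V
  | leaf _, _ => ∅
  | node v l r, x => insert v (if x v then r.queried x else l.queried x)

theorem card_queried_le [DecidableEq V] (t : DTree V) (x : V → Bool) :
    (t.queried x).card ≤ t.depth := by
  induction t with
  | leaf b => simp [queried]
  | node v l r hl hr =>
    refine (Finset.card_insert_le _ _).trans ?_
    simp only [depth]
    split <;> omega

theorem eval_eq_of_agree [DecidableEq V] (t : DTree V) (x y : V → Bool)
    (h : ∀ v ∈ t.queried x, y v = x v) : t.eval y = t.eval x := by
  induction t with
  | leaf b => rfl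
  | node v l r hl hr =>
    have hv : y v = x v := h v (by simp [queried])
    simp only [eval, hv]
    by_cases hx : x v = true
    · simp only [hx, if_true]
      exact hr fun u hu => h u (by simp [queried, hx, hu])
    · simp only [hx]
      exact hl fun u hu => h u (by simp [queried, hx, hu])

end DTree

/-! ### Certificates and functions sensitive to every variable -/

/-- The function `f` is computed by a decision tree of depth at most `k`. -/
def HasDTree {V : Type} (k : ℕ) (f : (V → Bool) → Bool) : Prop :=
  ∃ t : DTree V, t.depth ≤ k ∧ ∀ x, t.eval x = f x

/-- Every input accepted by `f` has a certificate of size at most `w`, that is, `f` is a DNF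
of width `w`. -/
def HasCert {V : Type} (w : ℕ) (f : (V → Bool) → Bool) : Prop :=
  ∀ x, f x = true → ∃ U : Finset V, U.card ≤ w ∧ ∀ y, (∀ v ∈ U, y v = x v) → f y = true

/-- Flipping any one input bit flips the value of `f`. -/
def FlipsAll {V : Type} [DecidableEq V] (f : (V → Bool) → Bool) : Prop :=
  ∀ x v, f (Function.update x v (!x v)) = !f x

section Basic

variable {V W : Type}

theorem HasDTree.mono {k m : ℕ} {f : (V → Bool) → Bool} (h : HasDTree k f) (hkm : k ≤ m) :
    HasDTree m f := by
  obtain ⟨t, ht, he⟩ := h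
  exact ⟨t, ht.trans hkm, he⟩

theorem HasDTree.not {k : ℕ} {f : (V → Bool) → Bool} (h : HasDTree k f) :
    HasDTree k fun x => !f x := by
  obtain ⟨t, ht, he⟩ := h
  exact ⟨t.neg, t.depth_neg.le.trans ht, fun x => by rw [t.eval_neg, he]⟩

theorem HasDTree.const (k : ℕ) {f : (V → Bool) → Bool} (b : Bool) (h : ∀ x, f x = b) :
    HasDTree k f :=
  ⟨.leaf b, Nat.zero_le _, fun x => (h x).symm⟩

theorem HasDTree.subst {k : ℕ} {f : (V → Bool) → Bool} (h : HasDTree k f) (σ : V → Bool ⊕ W) :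
    HasDTree k fun x : W → Bool => f fun v => Sum.elim id x (σ v) := by
  obtain ⟨t, ht, he⟩ := h
  exact ⟨t.subst σ, (t.depth_subst_le σ).trans ht, fun x => by rw [t.eval_subst, he]⟩

theorem HasDTree.hasCert {k : ℕ} {f : (V → Bool) → Bool} (h : HasDTree k f) : HasCert k f := by
  classical
  obtain ⟨t, ht, he⟩ := h
  intro x hx
  refine ⟨t.queried x, (t.card_queried_le x).trans ht, fun y hy => ?_⟩
  rw [← he, t.eval_eq_of_agree x y hy, he, hx]

theorem FlipsAll.not [DecidableEq V] {f : (V → Bool) → Bool} (h : FlipsAll f) :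
    FlipsAll fun x => !f x := fun x v => by simp [h x v]

/-- A certificate that omits a variable is refuted by flipping that variable. -/
theorem FlipsAll.card_le_of_hasCert [Fintype V] [DecidableEq V] {f : (V → Bool) → Bool} {w : ℕ}
    (hf : FlipsAll f) (hc : HasCert w f) : Fintype.card V ≤ w := by
  by_contra! hlt
  obtain ⟨x, hx⟩ : ∃ x, f x = true := by
    obtain ⟨v⟩ : Nonempty V := Fintype.card_pos_iff.1 (by omega)
    by_contra! hall
    have h := hf (fun _ => false) v
    simp only [Bool.not_eq_true] at hall
    simp [hall] at h
  obtain ⟨U, hU, hy⟩ := hc x hx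
  obtain ⟨v, hv⟩ : ∃ v, v ∉ U := by
    by_contra! h
    have : U = Finset.univ := Finset.eq_univ_iff_forall.2 h
    rw [this, Finset.card_univ] at hU
    omega
  have h1 := hy (Function.update x v (!x v)) fun u hu => by
    rw [Function.update_of_ne]
    rintro rfl
    exact hv hu
  rw [hf, hx] at h1
  simp at h1

end Basic

/-! ### Restrictions and DNFs -/

section Restriction

variable {V : Type}

/-- Fill in the unset variables of a restriction `ρ` by the input `x`. -/
def fillIn (ρ : V → Option Bool) (x : V → Bool) (v : V) : Bool := (ρ v).getD (x v)

/-- Set the variables in `P ⊆ U` to true and those in `U \ P` to false. -/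
def setOn [DecidableEq V] (ρ : V → Option Bool) (U P : Finset V) (v : V) : Option Bool :=
  if v ∈ U then some (decide (v ∈ P)) else ρ v

/-- Unset the variables in `U`. -/
def unsetOn [DecidableEq V] (ρ : V → Option Bool) (U : Finset V) (v : V) : Option Bool :=
  if v ∈ U then none else ρ v

/-- The unset variables of a restriction. -/
def stars [Fintype V] (ρ : V → Option Bool) : Finset V :=
  Finset.univ.filter fun v => ρ v = none

/-- The restrictions with exactly `l` unset variables. -/
def restrictions (V : Type) [Fintype V] [DecidableEq V] (l : ℕ) : Finset (V → Option Bool) :=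
  Finset.univ.filter fun ρ => (stars ρ).card = l

/-- A term: the conjunction of `x v = val v` over `v ∈ vars`. -/
structure Term (V : Type) where
  vars : Finset V
  val : V → Bool

/-- The term is true on the input `x`. -/
def Term.Holds (T : Term V) (x : V → Bool) : Prop := ∀ v ∈ T.vars, x v = T.val v

/-- The term is falsified by the restriction `ρ`. -/
def Term.Falsified (T : Term V) (ρ : V → Option Bool) : Prop :=
  ∃ v ∈ T.vars, ρ v = some (!T.val v)

open Classical in
/-- The value of a list of terms as a DNF. -/
noncomputable def dnfEval (F : List (Term V)) (x : V → Bool) : Bool := decide (∃ T ∈ F, T.Holds x)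

theorem HasCert.exists_dnf [Fintype V] [DecidableEq V] {w : ℕ} {f : (V → Bool) → Bool}
    (h : HasCert w f) :
    ∃ F : List (Term V), (∀ T ∈ F, T.vars.card ≤ w) ∧ ∀ x, dnfEval F x = f x := by
  classical
  choose! U hU hc using h
  refine ⟨((Finset.univ.filter fun x => f x = true).toList).map fun x => ⟨U x, x⟩, ?_, ?_⟩
  · intro T hT
    simp only [List.mem_map, Finset.mem_toList, Finset.mem_filter, Finset.mem_univ, true_and] at hT
    obtain ⟨x, hx, rfl⟩ := hT
    exact hU x hx
  · intro y
    rw [Bool.eq_iff_iff, dnfEval, decide_eq_true_iff]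
    simp only [List.mem_map, Finset.mem_toList, Finset.mem_filter, Finset.mem_univ, true_and]
    constructor
    · rintro ⟨T, ⟨x, hx, rfl⟩, hT⟩
      exact hc x hx y hT
    · intro hy
      exact ⟨_, ⟨y, hy, rfl⟩, fun v _ => rfl⟩

/-- Query all of `U` first, then run the tree for the assignment found. `P` is the set of variables
of `U` found true. -/
theorem hasDTree_of_setOn [DecidableEq V] (U : Finset V) (k : ℕ) (f : (V → Bool) → Bool)
    (h : ∀ P ⊆ U, HasDTree k fun x => f fun v => if v ∈ U then decide (v ∈ P) else x v) :
    HasDTree (k + U.card) f := by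
  induction U using Finset.induction_on generalizing f with
  | empty => simpa using h ∅ (by simp)
  | insert u U hu ih =>
    have key : ∀ b : Bool, HasDTree (k + U.card) fun x => f (Function.update x u b) := by
      intro b
      refine ih _ fun P hP => ?_
      have hup : u ∉ P := fun hp => hu (hP hp)
      have hQ := h (if b then insert u P else P) (by
        cases b
        · exact hP.trans (Finset.subset_insert _ _)
        · exact Finset.insert_subset_insert _ hP)
      convert hQ using 3 with x
      funext v
      by_cases hvu : v = u
      · subst hvu
        cases b <;> simp [hup]
      · cases b <;> simp [hvu]
    obtain ⟨t0, hd0, he0⟩ := key false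
    obtain ⟨t1, hd1, he1⟩ := key true
    refine ⟨.node u t0 t1, ?_, fun x => ?_⟩
    · rw [Finset.card_insert_of_notMem hu]
      simp only [DTree.depth]
      omega
    · simp only [DTree.eval, he0, he1]
      by_cases hx : x u = true
      · rw [if_pos hx, ← hx, Function.update_eq_self]
      · rw [if_neg hx]
        rw [Bool.not_eq_true] at hx
        rw [← hx, Function.update_eq_self]

/-! ### Encoding and decoding of bad restrictions -/

open Classical in
/-- The restrictions with `s` more unset variables that can be recovered from `τ` when the DNF
`F` is known. -/
noncomputable def decodeSet [DecidableEq V] :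
    List (Term V) → ℕ → (V → Option Bool) → Finset (V → Option Bool)
  | _, 0, τ => {τ}
  | [], _ + 1, _ => ∅
  | T :: F, s + 1, τ =>
    -- The first term not falsified by `τ` is the one the encoder worked on. It remains to guess
    -- which of its variables `U` were unset and which values `P` the encoder continued with.
    if T.Falsified τ then decodeSet F (s + 1) τ
    else (T.vars.powerset.filter fun U => U.Nonempty ∧ U.card ≤ s + 1).biUnion fun U =>
      U.powerset.biUnion fun P =>
        (decodeSet F (s + 1 - U.card) (setOn τ U P)).image fun ρ => unsetOn ρ U

theorem decodeSet_zero [DecidableEq V] (F : List (Term V)) (τ : V → Option Bool) :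
    decodeSet F 0 τ = {τ} := by
  cases F <;> rfl

-- Each nonempty `U` allows `2 ^ U.card` sets `P` and lowers `s` by `U.card`, so by induction it
-- contributes `(2 * K) ^ s * (1 / K) ^ U.card`. The binomial theorem bounds the sum of `(1 / K) ^
-- U.card` over nonempty `U` by `(1 + 1 / K) ^ w - 1 ≤ 1`.
open Classical in
theorem card_decodeSet_le [DecidableEq V] {K : ℝ} (hK : 0 < K) {w : ℕ}
    (hw : (1 + 1 / K) ^ w ≤ 2) (F : List (Term V)) (hF : ∀ T ∈ F, T.vars.card ≤ w) (s : ℕ)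
    (τ : V → Option Bool) : ((decodeSet F s τ).card : ℝ) ≤ (2 * K) ^ s := by
  induction F generalizing s τ with
  | nil =>
    cases s with
    | zero => simp [decodeSet]
    | succ s => simp only [decodeSet, Finset.card_empty, Nat.cast_zero]; positivity
  | cons T F ih =>
    have ih := ih fun T hT => hF T (List.mem_cons_of_mem _ hT)
    cases s with
    | zero => simp [decodeSet]
    | succ s =>
      rw [decodeSet]
      split_ifs with hfal
      · exact ih _ _
      set 𝒰 := T.vars.powerset.filter fun U => U.Nonempty ∧ U.card ≤ s + 1 with h𝒰
      have h1 : ∀ U ∈ 𝒰, ((U.powerset.biUnion fun P =>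
          (decodeSet F (s + 1 - U.card) (setOn τ U P)).image fun ρ => unsetOn ρ U).card : ℝ)
            ≤ (2 * K) ^ (s + 1) * (1 / K) ^ U.card := by
        intro U hU
        have hUs : U.card ≤ s + 1 := (Finset.mem_filter.1 hU).2.2
        have h2 : ((U.powerset.biUnion fun P =>
          (decodeSet F (s + 1 - U.card) (setOn τ U P)).image fun ρ => unsetOn ρ U).card : ℝ)
            ≤ ∑ P ∈ U.powerset, (2 * K) ^ (s + 1 - U.card) := by
          refine (Nat.cast_le.2 Finset.card_biUnion_le).trans ?_
          push_cast
          exact Finset.sum_le_sum fun P _ =>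
            (Nat.cast_le.2 Finset.card_image_le).trans (ih _ _)
        refine h2.trans (le_of_eq ?_)
        rw [Finset.sum_const, Finset.card_powerset, nsmul_eq_mul]
        push_cast
        obtain ⟨r, hr⟩ := Nat.exists_eq_add_of_le hUs
        rw [hr, Nat.add_sub_cancel_left, pow_add, mul_pow 2 K U.card, one_div, inv_pow]
        field_simp
      calc (((𝒰.biUnion fun U => U.powerset.biUnion fun P =>
          (decodeSet F (s + 1 - U.card) (setOn τ U P)).image fun ρ => unsetOn ρ U).card : ℕ) : ℝ)
          ≤ ∑ U ∈ 𝒰, (2 * K) ^ (s + 1) * (1 / K) ^ U.card := by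
            refine (Nat.cast_le.2 Finset.card_biUnion_le).trans ?_
            push_cast
            exact Finset.sum_le_sum h1
        _ = (2 * K) ^ (s + 1) * ∑ U ∈ 𝒰, (1 / K) ^ U.card := by rw [Finset.mul_sum]
        _ ≤ (2 * K) ^ (s + 1) * 1 := by
            refine mul_le_mul_of_nonneg_left ?_ (by positivity)
            -- The empty set accounts for the 1 that is subtracted.
            have h3 : ∑ U ∈ insert ∅ 𝒰, (1 / K) ^ U.card
                ≤ ∑ U ∈ T.vars.powerset, (1 / K) ^ U.card := by
              refine Finset.sum_le_sum_of_subset_of_nonneg ?_ fun _ _ _ => by positivity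
              intro U hU
              rcases Finset.mem_insert.1 hU with rfl | hU
              · simp
              · exact (Finset.mem_filter.1 hU).1
            rw [Finset.sum_insert (by simp [h𝒰])] at h3
            have h4 : ∑ U ∈ T.vars.powerset, (1 / K) ^ U.card = (1 + 1 / K) ^ T.vars.card := by
              have := Finset.prod_one_add (f := fun _ : V => 1 / K) T.vars
              simp only [Finset.prod_const] at this
              exact this.symm
            have h5 : (1 + 1 / K) ^ T.vars.card ≤ (1 + 1 / K) ^ w :=
              pow_le_pow_right₀ (by simp only [le_add_iff_nonneg_right]; positivity)
                (hF T (by simp))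
            simp only [Finset.card_empty, pow_zero] at h3
            linarith
        _ = (2 * K) ^ (s + 1) := mul_one _

variable [Fintype V] [DecidableEq V]

theorem card_stars_add_of_unsetOn {ρ τ : V → Option Bool} {U : Finset V}
    (hτ : ∀ v ∈ U, τ v ≠ none) (hρ : ∀ v ∈ U, ρ v = none) (h : ∀ v ∉ U, τ v = ρ v) :
    (stars τ).card + U.card = (stars ρ).card := by
  rw [← Finset.card_union_of_disjoint]
  · congr 1
    ext v
    by_cases hv : v ∈ U
    · simp [stars, hv, hρ v hv]
    · simp [stars, hv, h v hv]
  · rw [Finset.disjoint_left]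
    intro v hv hU
    exact hτ v hU (Finset.mem_filter.1 hv).2

/-- The encoder takes the first term `T` not falsified by `ρ` and sets its unset variables `U` so as
to satisfy `T`, which lets the decoder recognise `T`. The recursion instead continues from an
assignment `P` of `U` under which the DNF still needs depth `s - U.card`. -/
theorem mem_decodeSet (F : List (Term V)) (s : ℕ) (ρ : V → Option Bool)
    (hbad : ∀ k < s, ¬ HasDTree k fun x => dnfEval F (fillIn ρ x)) :
    ∃ τ, (∀ v, ρ v ≠ none → τ v = ρ v) ∧ (stars τ).card + s = (stars ρ).card ∧
      ρ ∈ decodeSet F s τ := by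
  induction F generalizing s ρ with
  | nil =>
    cases s with
    | zero => exact ⟨ρ, fun _ _ => rfl, rfl, by simp [decodeSet]⟩
    | succ s =>
      exact absurd (HasDTree.const 0 false fun x => by simp [dnfEval]) (hbad 0 (by omega))
  | cons T F ih =>
    cases s with
    | zero => exact ⟨ρ, fun _ _ => rfl, rfl, by simp [decodeSet]⟩
    | succ s =>
      have hdrop : ∀ ρ' : V → Option Bool, T.Falsified ρ' →
          ∀ x, dnfEval (T :: F) (fillIn ρ' x) = dnfEval F (fillIn ρ' x) := by
        rintro ρ' ⟨v, hv, hρv⟩ x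
        have : ¬ T.Holds (fillIn ρ' x) := by
          intro hT
          have := hT v hv
          simp [fillIn, hρv] at this
        simp [dnfEval, this]
      by_cases hfal : T.Falsified ρ
      · obtain ⟨τ, hext, hcard, hmem⟩ := ih (s + 1) ρ (by simpa only [hdrop ρ hfal] using hbad)
        refine ⟨τ, hext, hcard, ?_⟩
        have : T.Falsified τ := by
          obtain ⟨v, hv, hρv⟩ := hfal
          exact ⟨v, hv, by rw [hext v (by simp [hρv]), hρv]⟩
        rw [decodeSet, if_pos this]
        exact hmem
      · have hset : ∀ v ∈ T.vars, ρ v ≠ none → ρ v = some (T.val v) := by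
          intro v hv hne
          obtain ⟨b, hb⟩ := Option.ne_none_iff_exists'.1 hne
          by_contra hcon
          refine hfal ⟨v, hv, ?_⟩
          rw [hb] at hcon ⊢
          simp only [Option.some.injEq] at hcon ⊢
          cases b <;> cases h : T.val v <;> simp_all
        set U := T.vars.filter fun v => ρ v = none with hU
        have hUT : U ⊆ T.vars := Finset.filter_subset _ _
        have hUρ : ∀ v ∈ U, ρ v = none := fun v hv => (Finset.mem_filter.1 hv).2
        have hnotU : ∀ v ∈ T.vars, v ∉ U → ρ v = some (T.val v) := fun v hv hvU =>
          hset v hv fun h => hvU (Finset.mem_filter.2 ⟨hv, h⟩)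
        -- If `T` has enough unset variables, exactly `s + 1` of them are set and the encoding ends
        -- here.
        by_cases hsU : s + 1 ≤ U.card
        · obtain ⟨U', hU'U, hU'⟩ := Finset.exists_subset_card_eq hsU
          set τ : V → Option Bool := fun v => if v ∈ U' then some (T.val v) else ρ v with hτ
          refine ⟨τ, ?_, ?_, ?_⟩
          · intro v hv
            have : v ∉ U' := fun h => hv (hUρ v (hU'U h))
            simp [hτ, this]
          · rw [← hU']
            exact card_stars_add_of_unsetOn (by simp +contextual [hτ])
              (fun v hv => hUρ v (hU'U hv)) (by simp +contextual [hτ])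
          · have hnf : ¬ T.Falsified τ := by
              rintro ⟨v, hv, hτv⟩
              by_cases hvU' : v ∈ U'
              · simp [hτ, hvU'] at hτv
              · simp only [hτ, hvU', if_false] at hτv
                exact hfal ⟨v, hv, hτv⟩
            rw [decodeSet, if_neg hnf]
            simp only [Finset.mem_biUnion, Finset.mem_filter, Finset.mem_powerset,
              Finset.mem_image]
            refine ⟨U', ⟨hU'U.trans hUT, Finset.card_pos.1 (by omega), hU'.le⟩, ∅,
              Finset.empty_subset _, setOn τ U' ∅, ?_, ?_⟩
            · rw [hU', Nat.sub_self, decodeSet_zero]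
              simp
            · funext v
              by_cases hv : v ∈ U'
              · simp [unsetOn, hv, hUρ v (hU'U hv)]
              · simp [unsetOn, setOn, hv, hτ]
        · push Not at hsU
          obtain ⟨P, hPU, hP⟩ : ∃ P ⊆ U, ∀ k < s + 1 - U.card,
              ¬ HasDTree k fun x => dnfEval (T :: F) (fillIn (setOn ρ U P) x) := by
            -- Otherwise querying `U` and then using the shallow trees would give depth `s`.
            by_contra! hcon
            refine hbad s (by omega) ?_
            have := hasDTree_of_setOn U (s - U.card) (fun x => dnfEval (T :: F) (fillIn ρ x))
              fun P hP => by
                obtain ⟨k, hk, hDT⟩ := hcon P hP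
                have h := hDT.mono (show k ≤ s - U.card by omega)
                convert h using 3 with x
                funext v
                by_cases hv : v ∈ U
                · simp [fillIn, setOn, hv, hUρ v hv]
                · simp [fillIn, setOn, hv]
            rwa [Nat.sub_add_cancel (by omega)] at this
          set ρ' := setOn ρ U P with hρ'
          -- If `ρ'` did not falsify `T` it would satisfy it, as it sets all of its variables, and
          -- the DNF would be constant. So `T` can be dropped in the recursion.
          have hfal' : T.Falsified ρ' := by
            by_contra hnf
            refine hP 0 (by omega) (HasDTree.const 0 true fun x => ?_)
            have : T.Holds (fillIn ρ' x) := by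
              intro v hv
              by_contra hne
              refine hnf ⟨v, hv, ?_⟩
              by_cases hvU : v ∈ U
              · simp only [fillIn, hρ', setOn, hvU, if_true, Option.getD_some] at hne ⊢
                cases h : T.val v <;> simp_all
              · simp [fillIn, hρ', setOn, hvU, hnotU v hv hvU] at hne
            simp [dnfEval, this]
          have hUne : U.Nonempty := by
            obtain ⟨v, hv, hρv⟩ := hfal'
            by_contra hempty
            rw [Finset.not_nonempty_iff_eq_empty] at hempty
            refine hfal ⟨v, hv, ?_⟩
            rwa [hρ', setOn, if_neg (by simp [hempty])] at hρv
          obtain ⟨τ', hext, hcard, hmem⟩ := ih (s + 1 - U.card) ρ'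
            (by simpa only [hdrop ρ' hfal'] using hP)
          have hτ'U : ∀ v ∈ U, τ' v = some (decide (v ∈ P)) := by
            intro v hv
            have : ρ' v = some (decide (v ∈ P)) := by simp [hρ', setOn, hv]
            rw [hext v (by simp [this]), this]
          -- The recursive encoding, with the values on `U` replaced by those satisfying `T`; the
          -- decoder undoes this by means of `P`.
          set τ : V → Option Bool := fun v => if v ∈ U then some (T.val v) else τ' v with hτ
          have hτρ : ∀ v, ρ v ≠ none → τ v = ρ v := by
            intro v hv
            have hvU : v ∉ U := fun h => hv (hUρ v h)
            have : ρ' v = ρ v := by simp [hρ', setOn, hvU]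
            simp only [hτ, hvU, if_false]
            rw [hext v (by rwa [this]), this]
          refine ⟨τ, hτρ, ?_, ?_⟩
          · have h1 : (stars ρ').card + U.card = (stars ρ).card :=
              card_stars_add_of_unsetOn (by simp +contextual [hρ', setOn]) hUρ
                (by simp +contextual [hρ', setOn])
            have h2 : stars τ = stars τ' := by
              ext v
              by_cases hv : v ∈ U
              · simp [stars, hτ, hv, hτ'U v hv]
              · simp [stars, hτ, hv]
            rw [h2]
            omega
          · have hnf : ¬ T.Falsified τ := by
              rintro ⟨v, hv, hτv⟩
              by_cases hvU : v ∈ U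
              · simp [hτ, hvU] at hτv
              · rw [hτρ v (by simp [hnotU v hv hvU]), hnotU v hv hvU] at hτv
                simp at hτv
            rw [decodeSet, if_neg hnf]
            simp only [Finset.mem_biUnion, Finset.mem_filter, Finset.mem_powerset,
              Finset.mem_image]
            refine ⟨U, ⟨hUT, hUne, by omega⟩, P, hPU, ρ', ?_, ?_⟩
            · have : setOn τ U P = τ' := by
                funext v
                by_cases hv : v ∈ U
                · simp [setOn, hv, hτ'U v hv]
                · simp [setOn, hv, hτ]
              rw [this]
              exact hmem
            · funext v
              by_cases hv : v ∈ U
              · simp [unsetOn, hv, hUρ v hv]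
              · simp [unsetOn, hρ', setOn, hv]

/-! ### Counting restrictions -/

theorem card_restrictions (l : ℕ) :
    (restrictions V l).card = (Fintype.card V).choose l * 2 ^ (Fintype.card V - l) := by
  have h1 : restrictions V l = (Finset.univ.powersetCard l).biUnion fun S : Finset V =>
      Fintype.piFinset fun v => if v ∈ S then {none} else {some true, some false} := by
    ext ρ
    simp only [restrictions, Finset.mem_filter, Finset.mem_univ, true_and, Finset.mem_biUnion,
      Finset.mem_powersetCard, Finset.subset_univ, Fintype.mem_piFinset]
    constructor
    · intro h
      refine ⟨stars ρ, h, fun v => ?_⟩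
      by_cases hv : ρ v = none
      · simp [stars, hv]
      · obtain ⟨b, hb⟩ := Option.ne_none_iff_exists'.1 hv
        cases b <;> simp [stars, hb]
    · rintro ⟨S, hS, hρ⟩
      rw [← hS]
      congr 1
      ext v
      have := hρ v
      by_cases hv : v ∈ S
      · simp_all [stars]
      · simp only [hv, if_false, Finset.mem_insert, Finset.mem_singleton] at this
        rcases this with h | h <;> simp [stars, h, hv]
  rw [h1, Finset.card_biUnion]
  · rw [Finset.sum_congr rfl (g := fun _ => 2 ^ (Fintype.card V - l))]
    · simp
    · intro S hS
      rw [Fintype.card_piFinset]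
      have : ∀ v, (if v ∈ S then ({none} : Finset (Option Bool))
          else {some true, some false}).card = if v ∈ S then 1 else 2 := by
        intro v
        split_ifs <;> rfl
      simp only [this]
      rw [Finset.prod_ite]
      simp only [Finset.prod_const, one_pow, one_mul]
      congr 1
      rw [← (Finset.mem_powersetCard.1 hS).2, ← Finset.card_compl]
      congr 1
      ext v
      simp
  · intro S _ S' _ hne
    rw [Function.onFun, Finset.disjoint_left]
    intro ρ h h'
    refine hne (Finset.ext fun v => ?_)
    rw [Fintype.mem_piFinset] at h h'
    have h := h v
    have h' := h' v
    by_cases hv : v ∈ S <;> by_cases hv' : v ∈ S' <;> simp_all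

/-- Consecutive counts have the exact ratio `2 * (k + 1) / (Fintype.card V - k)`, and each of the
`s` ratios is at most its value with `l + s` in place of `k` and `k + 1`. -/
theorem card_restrictions_mul_pow_le {l s : ℕ} (h : l + s ≤ Fintype.card V) :
    (restrictions V l).card * (Fintype.card V - (l + s)) ^ s
      ≤ (restrictions V (l + s)).card * (2 * (l + s)) ^ s := by
  have step : ∀ k, k < Fintype.card V → (restrictions V k).card * (Fintype.card V - k)
      = (restrictions V (k + 1)).card * (2 * (k + 1)) := by
    intro k hk
    rw [card_restrictions, card_restrictions]
    have := Nat.choose_succ_right_eq (Fintype.card V) k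
    obtain ⟨r, hr⟩ : ∃ r, Fintype.card V - k = r + 1 := ⟨Fintype.card V - k - 1, by omega⟩
    have hr' : Fintype.card V - (k + 1) = r := by omega
    rw [hr] at this ⊢
    rw [hr']
    calc (Fintype.card V).choose k * 2 ^ (r + 1) * (r + 1)
        = (Fintype.card V).choose k * (r + 1) * 2 ^ (r + 1) := by ring
      _ = (Fintype.card V).choose (k + 1) * 2 ^ r * (2 * (k + 1)) := by rw [← this]; ring
  generalize hL : l + s = L at *
  have key : ∀ j ≤ s, (restrictions V l).card * (Fintype.card V - L) ^ j
      ≤ (restrictions V (l + j)).card * (2 * L) ^ j := by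
    intro j
    induction j with
    | zero => simp
    | succ j ih =>
      intro hj
      calc (restrictions V l).card * (Fintype.card V - L) ^ (j + 1)
          = (restrictions V l).card * (Fintype.card V - L) ^ j * (Fintype.card V - L) := by ring
        _ ≤ (restrictions V (l + j)).card * (2 * L) ^ j * (Fintype.card V - (l + j)) :=
            Nat.mul_le_mul (ih (by omega)) (by omega)
        _ = (restrictions V (l + j)).card * (Fintype.card V - (l + j)) * (2 * L) ^ j := by ring
        _ = (restrictions V (l + j + 1)).card * (2 * (l + j + 1)) * (2 * L) ^ j := by
            rw [step _ (by omega)]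
        _ ≤ (restrictions V (l + j + 1)).card * (2 * L) * (2 * L) ^ j := by
            gcongr
            omega
        _ = _ := by rw [← add_assoc]; ring
  have := key s le_rfl
  rwa [hL] at this

/-! ### The switching lemma and the union bound -/

open Classical in
/-- Håstad's switching lemma, counted over the restrictions with exactly `l` unset variables. -/
theorem switching {f : (V → Bool) → Bool} {w : ℕ} (hf : HasCert w f) {K : ℝ} (hK : 0 < K)
    (hw : (1 + 1 / K) ^ w ≤ 2) {l : ℕ} (hl : l < Fintype.card V)
    (hlK : 4 * K * l * Real.exp 1 ≤ Fintype.card V - l) (w' : ℕ) :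
    (((restrictions V l).filter fun ρ => ¬ HasDTree w' fun x => f (fillIn ρ x)).card : ℝ)
      * Real.exp 1 ^ (w' + 1) ≤ (restrictions V l).card := by
  obtain ⟨F, hFw, hF⟩ := hf.exists_dnf
  set s := w' + 1 with hs
  set B := (restrictions V l).filter fun ρ => ¬ HasDTree w' fun x => f (fillIn ρ x) with hB
  have hmem : ∀ ρ ∈ B, ∃ τ, (stars τ).card + s = l ∧ ρ ∈ decodeSet F s τ := by
    intro ρ hρ
    simp only [hB, restrictions, Finset.mem_filter, Finset.mem_univ, true_and] at hρ
    obtain ⟨τ, -, h1, h2⟩ := mem_decodeSet F s ρ (by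
      intro k hk h
      simp only [hF] at h
      exact hρ.2 (h.mono (by omega)))
    exact ⟨τ, h1.trans hρ.1, h2⟩
  rcases B.eq_empty_or_nonempty with h0 | ⟨ρ0, hρ0⟩
  · rw [h0]
    simp
  -- A single bad restriction already forces `s ≤ l`, since its encoding loses `s` stars.
  obtain ⟨r, rfl⟩ : ∃ r, l = r + s := by
    obtain ⟨τ, h, -⟩ := hmem ρ0 hρ0
    exact ⟨_, h.symm⟩
  have hcard : (B.card : ℝ) ≤ (restrictions V r).card * (2 * K) ^ s := by
    have hsub : B ⊆ (restrictions V r).biUnion fun τ => decodeSet F s τ := by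
      intro ρ hρ
      obtain ⟨τ, h1, h2⟩ := hmem ρ hρ
      rw [Finset.mem_biUnion]
      refine ⟨τ, ?_, h2⟩
      simp only [restrictions, Finset.mem_filter, Finset.mem_univ, true_and]
      omega
    refine (Nat.cast_le.2 ((Finset.card_le_card hsub).trans Finset.card_biUnion_le)).trans ?_
    push_cast
    refine (Finset.sum_le_sum fun τ _ => card_decodeSet_le hK hw F hFw s τ).trans ?_
    rw [Finset.sum_const, nsmul_eq_mul]
  have hratio : ((restrictions V r).card : ℝ) * (Fintype.card V - (r + s : ℕ)) ^ s
      ≤ (restrictions V (r + s)).card * (2 * (r + s : ℕ)) ^ s := by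
    have := card_restrictions_mul_pow_le (V := V) hl.le
    rw [← Nat.cast_sub hl.le]
    exact_mod_cast this
  set D : ℝ := Fintype.card V - (r + s : ℕ) with hD
  have hDpos : 0 < D := sub_pos.2 (Nat.cast_lt.2 hl)
  refine le_of_mul_le_mul_right ?_ (pow_pos hDpos s)
  calc (B.card : ℝ) * Real.exp 1 ^ s * D ^ s
      ≤ (restrictions V r).card * (2 * K) ^ s * Real.exp 1 ^ s * D ^ s := by gcongr
    _ = (restrictions V r).card * D ^ s * (2 * K * Real.exp 1) ^ s := by
        rw [mul_pow (2 * K)]; ring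
    _ ≤ (restrictions V (r + s)).card * (2 * (r + s : ℕ)) ^ s * (2 * K * Real.exp 1) ^ s := by
        gcongr
    _ = (restrictions V (r + s)).card * (4 * K * (r + s : ℕ) * Real.exp 1) ^ s := by
        rw [mul_assoc, ← mul_pow]; congr 2; ring
    _ ≤ (restrictions V (r + s)).card * D ^ s := by gcongr

open Classical in
theorem exists_good_restriction {ι : Type} (J : Finset ι) (f : ι → (V → Bool) → Bool) {w : ℕ}
    (hf : ∀ j ∈ J, HasCert w (f j) ∨ HasCert w fun x => !f j x) {K : ℝ} (hK : 0 < K)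
    (hw : (1 + 1 / K) ^ w ≤ 2) {l : ℕ} (hl : l < Fintype.card V)
    (hlK : 4 * K * l * Real.exp 1 ≤ Fintype.card V - l) (w' : ℕ)
    (hJ : (J.card : ℝ) < Real.exp 1 ^ (w' + 1)) :
    ∃ ρ : V → Option Bool, (stars ρ).card = l ∧
      ∀ j ∈ J, HasDTree w' fun x => f j (fillIn ρ x) := by
  have hbad : ∀ j ∈ J,
      (((restrictions V l).filter fun ρ => ¬ HasDTree w' fun x => f j (fillIn ρ x)).card : ℝ)
        * Real.exp 1 ^ (w' + 1) ≤ (restrictions V l).card := by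
    intro j hj
    rcases hf j hj with h | h
    · exact switching h hK hw hl hlK w'
    · have := switching h hK hw hl hlK w'
      -- Negating leaves preserves depth, so a function and its negation have the same bad
      -- restrictions.
      have heq : ∀ ρ : V → Option Bool, (HasDTree w' fun x => !f j (fillIn ρ x)) ↔
          HasDTree w' fun x => f j (fillIn ρ x) := fun ρ =>
        ⟨fun h => by simpa using h.not, fun h => h.not⟩
      simpa only [heq] using this
  have hpos : (0 : ℝ) < (restrictions V l).card := by
    rw [card_restrictions]
    have := Nat.choose_pos hl.le
    positivity
  by_contra! hcon
  have hsub : restrictions V l ⊆ J.biUnion fun j =>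
      (restrictions V l).filter fun ρ => ¬ HasDTree w' fun x => f j (fillIn ρ x) := by
    intro ρ hρ
    obtain ⟨j, hj, hjρ⟩ := hcon ρ (Finset.mem_filter.1 hρ).2
    exact Finset.mem_biUnion.2 ⟨j, hj, Finset.mem_filter.2 ⟨hρ, hjρ⟩⟩
  have h1 : ((restrictions V l).card : ℝ) ≤ ∑ j ∈ J,
      (((restrictions V l).filter fun ρ => ¬ HasDTree w' fun x => f j (fillIn ρ x)).card : ℝ) := by
    exact_mod_cast (Finset.card_le_card hsub).trans Finset.card_biUnion_le
  have h2 : ((restrictions V l).card : ℝ) * Real.exp 1 ^ (w' + 1)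
      ≤ J.card * (restrictions V l).card := by
    refine (mul_le_mul_of_nonneg_right h1 (by positivity)).trans ?_
    rw [Finset.sum_mul]
    refine (Finset.sum_le_sum hbad).trans ?_
    rw [Finset.sum_const, nsmul_eq_mul]
  nlinarith

end Restriction

/-! ### Passing to the unset variables -/

section Lift

variable {V : Type}

/-- The input on all variables given by a restriction and an input on its unset variables. -/
def liftInput (ρ : V → Option Bool) (x : {v // ρ v = none} → Bool) (v : V) : Bool :=
  if h : ρ v = none then x ⟨v, h⟩ else fillIn ρ (fun _ => false) v

theorem HasDTree.liftInput {ρ : V → Option Bool} {k : ℕ} {f : (V → Bool) → Bool}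
    (h : HasDTree k fun x => f (fillIn ρ x)) : HasDTree k fun x => f (liftInput ρ x) := by
  -- The constant `false` is arbitrary: `fillIn ρ` ignores the input at set variables.
  have := h.subst fun v => if h : ρ v = none then Sum.inr (⟨v, h⟩ : {v // ρ v = none})
    else Sum.inl false
  convert this using 3 with x
  funext v
  by_cases hv : ρ v = none
  · simp [_root_.liftInput, fillIn, hv]
  · obtain ⟨b, hb⟩ := Option.ne_none_iff_exists'.1 hv
    simp [_root_.liftInput, fillIn, hb]

theorem HasDTree.fillIn {ρ : V → Option Bool} {k : ℕ} {f : (V → Bool) → Bool}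
    (h : HasDTree k f) : HasDTree k fun x => f (fillIn ρ x) := by
  have := h.subst fun v => (ρ v).elim (Sum.inr v) Sum.inl
  convert this using 3 with x
  funext v
  cases hv : ρ v <;> simp [_root_.fillIn, hv]

theorem FlipsAll.liftInput [DecidableEq V] {f : (V → Bool) → Bool} (h : FlipsAll f)
    (ρ : V → Option Bool) : FlipsAll fun x => f (liftInput ρ x) := by
  intro x u
  have : _root_.liftInput ρ (Function.update x u (!x u))
      = Function.update (_root_.liftInput ρ x) u.1 (!_root_.liftInput ρ x u.1) := by
    funext v
    by_cases hv : v = u.1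
    · subst hv
      simp [_root_.liftInput, u.2]
    · rw [Function.update_of_ne hv]
      simp only [_root_.liftInput]
      split_ifs with h
      · rw [Function.update_of_ne]
        exact fun h' => hv (congrArg Subtype.val h')
      · rfl
  change f _ = !f _
  rw [this]
  exact h _ _

end Lift

theorem flipsAll_parity (n : ℕ) : FlipsAll (parity n) := by
  intro x v
  have h1 := Finset.add_sum_erase Finset.univ (fun i => (x i).toNat) (Finset.mem_univ v)
  have h2 := Finset.add_sum_erase Finset.univ
    (fun i => (Function.update x v (!x v) i).toNat) (Finset.mem_univ v)
  have h3 : ∑ i ∈ Finset.univ.erase v, (Function.update x v (!x v) i).toNat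
      = ∑ i ∈ Finset.univ.erase v, (x i).toNat :=
    Finset.sum_congr rfl fun i hi => by rw [Function.update_of_ne (Finset.ne_of_mem_erase hi)]
  simp only [h3, Function.update_self] at h2
  simp only [parity]
  rw [← h1, ← h2]
  generalize ∑ i ∈ Finset.univ.erase v, (x i).toNat = S
  rw [Bool.eq_iff_iff]
  cases x v <;> simp <;> omega

/-! ### Depth reduction for circuits -/

namespace BooleanCircuit

variable {n : ℕ} {V : Type}

/-- Once the nodes of depth at most `i` are shallow decision trees, a gate of depth at most
`i + 1` or its negation has small certificates. -/
theorem hasCert_of_isAndOr (C : BooleanCircuit n) (e : (V → Bool) → Fin n → Bool) {i w : ℕ}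
    (h : ∀ k, C.nodeDepth k ≤ i → HasDTree w fun x => C.nodeVal (e x) k)
    (k : Fin C.numNodes) (hk : C.nodeDepth k ≤ i + 1) (hg : (C.node k).isAndOr = true) :
    HasCert w (fun x => C.nodeVal (e x) k) ∨ HasCert w fun x => !C.nodeVal (e x) k := by
  have hor : ∀ s : Finset (Fin k.1), ∀ g : Fin k.1 → (V → Bool) → Bool,
      (∀ j ∈ s, HasDTree w (g j)) → ∀ x, (∃ j ∈ s, g j x = true) →
        ∃ U : Finset V, U.card ≤ w ∧ ∀ y, (∀ v ∈ U, y v = x v) → ∃ j ∈ s, g j y = true := by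
    rintro s g hs x ⟨j, hj, hx⟩
    obtain ⟨U, hU, hy⟩ := (hs j hj).hasCert x hx
    exact ⟨U, hU, fun y hyU => ⟨j, hj, hy y hyU⟩⟩
  rw [nodeDepth] at hk
  rcases hnode : C.node k with a | j | s | s
  · simp [hnode, BooleanGate.isAndOr] at hg
  · simp [hnode, BooleanGate.isAndOr] at hg
  -- By De Morgan, the negation of an AND is an OR of negated trees.
  · right
    simp only [hnode] at hk
    have hs : ∀ j ∈ s, HasDTree w fun x => !C.nodeVal (e x) ⟨j.val, j.isLt.trans k.isLt⟩ :=
      fun j hj => (h _ ((Finset.le_sup (f := fun j : Fin k.1 =>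
        C.nodeDepth ⟨j.val, j.isLt.trans k.isLt⟩) hj).trans (Nat.le_of_succ_le_succ hk))).not
    have hval : ∀ x, (!C.nodeVal (e x) k) = true ↔
        ∃ j ∈ s, (!C.nodeVal (e x) ⟨j.val, j.isLt.trans k.isLt⟩) = true := by
      intro x
      rw [nodeVal]
      simp [hnode]
    simpa only [HasCert, hval] using hor s _ hs
  · left
    simp only [hnode] at hk
    have hs : ∀ j ∈ s, HasDTree w fun x => C.nodeVal (e x) ⟨j.val, j.isLt.trans k.isLt⟩ :=
      fun j hj => h _ ((Finset.le_sup (f := fun j : Fin k.1 =>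
        C.nodeDepth ⟨j.val, j.isLt.trans k.isLt⟩) hj).trans (Nat.le_of_succ_le_succ hk))
    have hval : ∀ x, C.nodeVal (e x) k = true ↔
        ∃ j ∈ s, C.nodeVal (e x) ⟨j.val, j.isLt.trans k.isLt⟩ = true := by
      intro x
      rw [nodeVal]
      simp [hnode]
    simpa only [HasCert, hval] using hor s _ hs

/-- A property of Boolean functions that is closed under negation and holds for the input
variables and the gates of depth at most `i` holds for all nodes of depth at most `i`. -/
theorem forall_node_of_gates (C : BooleanCircuit n) (e : (V → Bool) → Fin n → Bool) (i : ℕ)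
    (Q : ((V → Bool) → Bool) → Prop) (hvar : ∀ a, Q fun x => e x a)
    (hnot : ∀ f, Q f → Q fun x => !f x)
    (hgate : ∀ k, C.nodeDepth k ≤ i → (C.node k).isAndOr = true → Q fun x => C.nodeVal (e x) k)
    (k : Fin C.numNodes) (hk : C.nodeDepth k ≤ i) : Q fun x => C.nodeVal (e x) k := by
  obtain ⟨m, hm⟩ := k
  induction m using Nat.strong_induction_on with
  | _ m ih =>
    rcases hnode : C.node ⟨m, hm⟩ with a | j | s | s
    · have : ∀ x, C.nodeVal (e x) ⟨m, hm⟩ = e x a := fun x => by rw [nodeVal]; simp [hnode]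
      simpa only [this] using hvar a
    · have h1 : ∀ x, C.nodeVal (e x) ⟨m, hm⟩ = !C.nodeVal (e x) ⟨j.val, j.isLt.trans hm⟩ :=
        fun x => by rw [nodeVal]; simp [hnode]
      have h2 : C.nodeDepth ⟨m, hm⟩ = C.nodeDepth ⟨j.val, j.isLt.trans hm⟩ := by
        rw [nodeDepth]; simp [hnode]
      simpa only [h1] using hnot _ (ih j.val j.isLt _ (h2 ▸ hk))
    · exact hgate _ hk (by simp [hnode, BooleanGate.isAndOr])
    · exact hgate _ hk (by simp [hnode, BooleanGate.isAndOr])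

/-- The circuit has been restricted to a subcube with `N` free variables on which all its nodes
of depth at most `i` are decision trees of depth at most `w`, and `f` is still flipped by every
variable. -/
def Simplified (C : BooleanCircuit n) (f : (Fin n → Bool) → Bool) (i w N : ℕ) : Prop :=
  ∃ (V : Type) (_ : Fintype V) (_ : DecidableEq V) (e : (V → Bool) → Fin n → Bool),
    Fintype.card V = N ∧ (∀ a, HasDTree 1 fun x => e x a) ∧
    FlipsAll (fun x => f (e x)) ∧
    ∀ k, C.nodeDepth k ≤ i → HasDTree w fun x => C.nodeVal (e x) k

theorem simplified_zero (C : BooleanCircuit n) {f : (Fin n → Bool) → Bool} (hf : FlipsAll f) :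
    C.Simplified f 0 1 n := by
  have hvar : ∀ a : Fin n, HasDTree 1 fun x : Fin n → Bool => x a := fun a =>
    ⟨.node a (.leaf false) (.leaf true), by simp [DTree.depth], fun x => by simp [DTree.eval]⟩
  refine ⟨Fin n, inferInstance, inferInstance, id, Fintype.card_fin n, hvar, hf, ?_⟩
  refine C.forall_node_of_gates id 0 (HasDTree 1) hvar (fun _ => HasDTree.not) ?_
  intro k hk hg
  rw [nodeDepth] at hk
  rcases hnode : C.node k with a | j | s | s <;> simp [hnode, BooleanGate.isAndOr] at hk hg

theorem Simplified.step {C : BooleanCircuit n} {f : (Fin n → Bool) → Bool} {i w N : ℕ}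
    (h : C.Simplified f i w N) {K : ℝ} (hK : 0 < K) (hw : (1 + 1 / K) ^ w ≤ 2) {w' : ℕ}
    (hw' : 1 ≤ w') (hsize : (C.size : ℝ) < Real.exp 1 ^ (w' + 1)) (hN : 0 < N) {q : ℕ}
    (hq : 4 * K * Real.exp 1 + 1 ≤ q) : C.Simplified f (i + 1) w' (N / q) := by
  classical
  obtain ⟨V, _, _, e, hcard, hvar, hflip, hnode⟩ := h
  have hq1 : 1 < q := by
    have : (1 : ℝ) < q := lt_of_lt_of_le (by simp only [lt_add_iff_pos_left]; positivity) hq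
    exact_mod_cast this
  obtain ⟨ρ, hstars, hρ⟩ := exists_good_restriction
    (Finset.univ.filter fun k => C.nodeDepth k ≤ i + 1 ∧ (C.node k).isAndOr = true)
    (fun k x => C.nodeVal (e x) k)
    (fun k hk => C.hasCert_of_isAndOr e hnode k (Finset.mem_filter.1 hk).2.1
      (Finset.mem_filter.1 hk).2.2) hK hw
    -- With `l * q ≤ N`, the bound `4 * K * e + 1 ≤ q` gives `4 * K * l * e ≤ N - l`.
    (l := N / q) (by rw [hcard]; exact Nat.div_lt_self hN hq1)
    (by
      rw [hcard]
      have h1 : ((N / q : ℕ) : ℝ) * q ≤ N := by exact_mod_cast Nat.div_mul_le_self N q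
      have h2 := mul_le_mul_of_nonneg_left hq (Nat.cast_nonneg (α := ℝ) (N / q))
      linarith) w'
    (lt_of_le_of_lt (Nat.cast_le.2 (Finset.card_le_card fun k hk => by
      simp only [Finset.mem_filter] at hk ⊢
      exact ⟨hk.1, hk.2.2⟩)) hsize)
  have hvar' : ∀ a, HasDTree 1 fun x => e (liftInput ρ x) a := fun a =>
    ((hvar a).fillIn (ρ := ρ)).liftInput (f := fun x => e x a)
  refine ⟨{v // ρ v = none}, inferInstance, inferInstance, fun x => e (liftInput ρ x), ?_,
    hvar', hflip.liftInput ρ, ?_⟩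
  · rw [Fintype.card_subtype, ← hstars]
    rfl
  · refine C.forall_node_of_gates _ (i + 1) (HasDTree w') (fun a => (hvar' a).mono hw')
      (fun _ => HasDTree.not) fun k hk hg => ?_
    exact (hρ k (Finset.mem_filter.2 ⟨Finset.mem_univ _, hk, hg⟩)).liftInput
      (f := fun x => C.nodeVal (e x) k)

theorem Simplified.not_computes {C : BooleanCircuit n} {f : (Fin n → Bool) → Bool} {i w N : ℕ}
    (h : C.Simplified f i w N) (hw : 1 ≤ w) (hN : w < N) (hd : C.depth ≤ i + 1) :
    ¬ C.Computes f := by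
  intro hC
  obtain ⟨V, _, _, e, hcard, hvar, hflip, hnode⟩ := h
  -- The output may be a chain of NOT gates above a gate or a variable, hence a property closed
  -- under negation.
  have hout := C.forall_node_of_gates e (i + 1)
    (fun g => HasCert w g ∨ HasCert w fun x => !g x)
    (fun a => Or.inl ((hvar a).mono hw).hasCert)
    (fun g hg => by simpa only [Bool.not_not] using hg.symm)
    (fun k hk hg => C.hasCert_of_isAndOr e hnode k hk hg) C.output hd
  simp only [hC _] at hout
  have : Fintype.card V ≤ w := by
    rcases hout with h | h
    · exact hflip.card_le_of_hasCert h
    · exact hflip.not.card_le_of_hasCert h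
  omega

/-- Lower bound for functions flipped by every variable, in terms of integer parameters. -/
theorem not_computes_of_params {f : (Fin n → Bool) → Bool} (hf : FlipsAll f)
    (C : BooleanCircuit n) {i w q : ℕ} (hd : C.depth ≤ i + 2) (hw : 1 ≤ w)
    (hsize : (C.size : ℝ) < Real.exp 1 ^ (w + 1))
    (hq : 4 * (w / Real.log 2) * Real.exp 1 + 1 ≤ q) (hn : 12 * q ^ i * (w + 1) ≤ n) :
    ¬ C.Computes f := by
  have hwpos : (0 : ℝ) < w := by exact_mod_cast hw
  have hlog : 0 < Real.log 2 := Real.log_pos one_lt_two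
  have hq1 : 0 < q := by
    have : (0 : ℝ) < q := lt_of_lt_of_le (by positivity) hq
    exact_mod_cast this
  have hmain : ∀ j ≤ i, C.Simplified f (j + 1) w (n / (12 * q ^ j)) := by
    intro j
    induction j with
    | zero =>
      intro _
      rw [pow_zero, mul_one]
      -- The first round has width 1 and `K = 1`, for which `12 ≥ 4 * e + 1` suffices.
      refine (C.simplified_zero hf).step one_pos (by norm_num) hw hsize ?_ ?_
      · exact lt_of_lt_of_le (by positivity) hn
      · have := Real.exp_one_lt_d9
        push_cast
        linarith
    | succ j ih =>
      intro hj
      rw [pow_succ, ← mul_assoc, ← Nat.div_div_eq_div_mul]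
      -- This `K` is admissible because `1 + log 2 / w ≤ exp (log 2 / w)`.
      refine (ih (by omega)).step (K := w / Real.log 2) (by positivity) ?_ hw hsize ?_ hq
      · have h1 : 1 + 1 / ((w : ℝ) / Real.log 2) ≤ Real.exp (Real.log 2 / w) := by
          rw [one_div_div, add_comm]
          exact Real.add_one_le_exp _
        calc (1 + 1 / ((w : ℝ) / Real.log 2)) ^ w ≤ Real.exp (Real.log 2 / w) ^ w := by
              gcongr
          _ = 2 := by
              rw [← Real.exp_nat_mul, mul_div_cancel₀ _ hwpos.ne', Real.exp_log two_pos]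
      · refine Nat.div_pos (le_trans ?_ hn) (by positivity)
        calc 12 * q ^ j ≤ 12 * q ^ i := by
              gcongr
              omega
          _ ≤ 12 * q ^ i * (w + 1) := Nat.le_mul_of_pos_right _ (by omega)
  refine (hmain i le_rfl).not_computes hw ?_ hd
  rw [← Nat.succ_le_iff, Nat.le_div_iff_mul_le (by positivity), mul_comm]
  exact hn

end BooleanCircuit

/-! ### Choice of parameters -/

theorem mainTheorem2 (d : ℕ) (hd : 2 ≤ d) :
    ∀ᶠ n : ℕ in Filter.atTop,
      ¬ ∃ C : BooleanCircuit n,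
        C.Computes (parity n) ∧ C.depth ≤ d ∧
          (C.size : ℝ) ≤ (2 : ℝ) ^ ((1 / 11 : ℝ) * (n : ℝ) ^ ((1 : ℝ) / ((d : ℝ) - 1))) := by
  obtain ⟨i, rfl⟩ := Nat.exists_eq_add_of_le' hd
  have hexp : ((i + 2 : ℕ) : ℝ) - 1 = (i + 1 : ℕ) := by push_cast; ring
  have hlim : Filter.Tendsto (fun n : ℕ => (n : ℝ) ^ ((1 : ℝ) / (((i + 2 : ℕ) : ℝ) - 1)))
      Filter.atTop Filter.atTop :=
    (tendsto_rpow_atTop (by rw [hexp]; positivity)).comp tendsto_natCast_atTop_atTop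
  filter_upwards [hlim.eventually_ge_atTop 300] with n hm
  rintro ⟨C, hC, hdepth, hsize⟩
  set m : ℝ := (n : ℝ) ^ ((1 : ℝ) / (((i + 2 : ℕ) : ℝ) - 1)) with hm_def
  have hmn : m ^ (i + 1) = n := by
    rw [hm_def, hexp, one_div, Real.rpow_inv_natCast_pow (Nat.cast_nonneg _) (by omega)]
  have hlog1 := Real.log_two_gt_d9
  have hlog2 := Real.log_two_lt_d9
  have he := Real.exp_one_lt_d9
  have hy0 : 0 ≤ m * Real.log 2 / 11 := by positivity
  -- The width is such that `exp (w + 1)` just exceeds the size bound `2 ^ (m / 11)`.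
  set w := ⌊m * Real.log 2 / 11⌋₊ with hw
  have hw_le : (w : ℝ) ≤ m * Real.log 2 / 11 := Nat.floor_le hy0
  have hw_lt : m * Real.log 2 / 11 < w + 1 := Nat.lt_floor_add_one _
  set q := ⌈4 * Real.exp 1 / 11 * m + 1⌉₊ with hq
  have hq_le : 4 * Real.exp 1 / 11 * m + 1 ≤ q := Nat.le_ceil _
  have hq_lt : (q : ℝ) < 4 * Real.exp 1 / 11 * m + 1 + 1 := Nat.ceil_lt_add_one (by positivity)
  -- As `4 * e / 11` is about 0.9885, the slack of roughly `0.0115 * m` absorbs the additive 2 once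
  -- `m ≥ 300`.
  have hqm : (q : ℝ) ≤ m := by nlinarith
  have hwm : 12 * ((w : ℝ) + 1) ≤ m := by nlinarith
  refine C.not_computes_of_params (flipsAll_parity n) (i := i) (w := w) (q := q) hdepth ?_ ?_ ?_ ?_
    hC
  · exact Nat.le_floor (by push_cast; nlinarith)
  · refine hsize.trans_lt ?_
    rw [Real.rpow_def_of_pos two_pos, ← Real.exp_nat_mul, Real.exp_lt_exp]
    push_cast
    linarith
  · refine le_trans ?_ hq_le
    have : (w : ℝ) / Real.log 2 ≤ m / 11 := by
      rw [div_le_iff₀ (by linarith)]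
      linarith
    have := mul_le_mul_of_nonneg_right this (Real.exp_pos 1).le
    linarith
  · have : (12 * q ^ i * (w + 1) : ℝ) ≤ n := by
      calc (12 * q ^ i * (w + 1) : ℝ) = q ^ i * (12 * (w + 1)) := by ring
        _ ≤ m ^ i * m := by gcongr
        _ = n := by rw [← pow_succ, hmn]
    exact_mod_cast this
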